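/- For $0<\theta<\pi$ let $\Sigma_\theta := \{ r e^{i\varphi} : r > 0,\ -\theta < \varphi < \theta \} \subset \mathbb{C}$. There exist a complex Banach space $X$ and a bounded linear operator $Q$ on $X$ with $\sigma(Q) = \{0\}$ (a quasinilpotent operator) such that the following two assertions hold. 1. For some $0 < \delta < \pi/2$ we have $\sup_{s \in \Sigma_\delta} \| (I - sQ)^{-1} \| < \infty$; hence $\Sigma_\delta \subset \mathcal{A}_Q := \{ z \in \mathbb{C} : \limsup_{s \to +\infty} \|(I - s z Q)^{-1}\| < \infty \}$. 2. The semigroup $e^{tQ}$ has no polynomial bound at infinity: for no integer $k \ge 1$ and no constants $M_k < \infty$ and $t_0 \ge 0$ does the estimate $\|e^{tQ}\| \le M_k t^k$ hold for all $t \ge t_0$. -/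

import Mathlib

namespace Microspectral

/-- The balanced open sector `{ r e^{i φ} : r > 0, φ ∈ (-θ, θ) }` of the complex plane. -/
def sector (θ : ℝ) : Set ℂ :=
  {z | ∃ r φ : ℝ, 0 < r ∧ φ ∈ Set.Ioo (-θ) θ ∧ z = (r : ℂ) * Complex.exp ((φ : ℂ) * Complex.I)}

/-- A bounded operator is quasinilpotent if its spectrum is `{0}`. -/
def IsQuasinilpotent {X : Type*} [NormedAddCommGroup X] [NormedSpace ℂ X] (Q : X →L[ℂ] X) : Prop :=
  spectrum ℂ Q = {0}

/-- The resolvent `(I - s Q)⁻¹`. For quasinilpotent `Q` the operator `I - s Q` is invertible for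
every complex `s`, so that `Ring.inverse` is the genuine inverse. -/
noncomputable def resolv {X : Type*} [NormedAddCommGroup X] [NormedSpace ℂ X]
    (Q : X →L[ℂ] X) (s : ℂ) : X →L[ℂ] X :=
  Ring.inverse (1 - s • Q)

/-- For quasinilpotent `Q`, the resolvent is a two-sided inverse of `I - s Q`. -/
theorem resolv_spec {X : Type*} [NormedAddCommGroup X] [NormedSpace ℂ X]
    {Q : X →L[ℂ] X} (hQ : IsQuasinilpotent Q) (s : ℂ) :
    (1 - s • Q) * resolv Q s = 1 ∧ resolv Q s * (1 - s • Q) = 1 := by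
  have hu : IsUnit (1 - s • Q) := by
    rcases eq_or_ne s 0 with rfl | hs
    · simp
    · have h1 : s⁻¹ ∉ spectrum ℂ Q := by
        rw [hQ]
        simpa using hs
      rw [spectrum.notMem_iff] at h1
      have h2 : (1 - s • Q) = (Units.mk0 s hs) • (algebraMap ℂ (X →L[ℂ] X) s⁻¹ - Q) := by
        rw [Units.smul_mk0, smul_sub, Algebra.algebraMap_eq_smul_one, smul_smul,
          mul_inv_cancel₀ hs, one_smul]
      rw [h2]
      exact h1.smul _
  exact ⟨Ring.mul_inverse_cancel _ hu, Ring.inverse_mul_cancel _ hu⟩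

/-- The Abel set of `Q`: all complex `z` with `limsup_{s → +∞} ‖(I - s z Q)⁻¹‖ < ∞`. -/
def abelSet {X : Type*} [NormedAddCommGroup X] [NormedSpace ℂ X] (Q : X →L[ℂ] X) : Set ℂ :=
  {z | ∃ C : ℝ, ∀ᶠ s : ℝ in Filter.atTop, ‖resolv Q ((s : ℂ) * z)‖ ≤ C}

end Microspectral

namespace Microspectral

open MeasureTheory intervalIntegral

/-- `x ↦ e^{w x} ∫₀ˣ e^{-w t} f t dt`, the solution of `h' = w h + f`, `h 0 = 0`. -/
noncomputable def duhamelFun (w : ℂ) (f : C(unitInterval, ℂ)) (x : ℝ) : ℂ :=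
  Complex.exp (w * x) * ∫ t in (0 : ℝ)..x,
    Complex.exp (-(w * t)) * f (Set.projIcc 0 1 zero_le_one t)

theorem continuous_duhamel_integrand (w : ℂ) (f : C(unitInterval, ℂ)) :
    Continuous fun t : ℝ => Complex.exp (-(w * t)) * f (Set.projIcc 0 1 zero_le_one t) := by
  have := continuous_projIcc (a := (0 : ℝ)) (b := 1) (h := zero_le_one)
  fun_prop

theorem hasDerivAt_duhamelFun (w : ℂ) (f : C(unitInterval, ℂ)) (x : ℝ) :
    HasDerivAt (duhamelFun w f)
      (w * duhamelFun w f x + f (Set.projIcc 0 1 zero_le_one x)) x := by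
  have hc := continuous_duhamel_integrand w f
  have h1 := integral_hasDerivAt_right (hc.intervalIntegrable 0 x)
    (hc.stronglyMeasurableAtFilter _ _) hc.continuousAt
  have h2 : HasDerivAt (fun x : ℝ => Complex.exp (w * x)) (Complex.exp (w * x) * w) x := by
    have h3 : HasDerivAt (fun x : ℝ => w * (x : ℂ)) w x := by
      simpa using (Complex.ofRealCLM.hasDerivAt (x := x)).const_mul w
    exact h3.cexp
  refine (h2.mul h1).congr_deriv ?_
  rw [← mul_assoc (Complex.exp (w * x)) (Complex.exp _), ← Complex.exp_add, duhamelFun]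
  simp only [add_neg_cancel, Complex.exp_zero]
  ring

theorem continuous_duhamelFun (w : ℂ) (f : C(unitInterval, ℂ)) : Continuous (duhamelFun w f) :=
  continuous_iff_continuousAt.2 fun x => (hasDerivAt_duhamelFun w f x).continuousAt

/-- `duhamelFun` as an operator on `C([0,1], ℂ)`, without continuity. -/
noncomputable def duhamelLin (w : ℂ) : C(unitInterval, ℂ) →ₗ[ℂ] C(unitInterval, ℂ) where
  toFun f := ⟨fun x => duhamelFun w f x,
    (continuous_duhamelFun w f).comp continuous_subtype_val⟩
  map_add' f g := by
    ext x
    simp only [duhamelFun, ContinuousMap.coe_mk, ContinuousMap.add_apply, mul_add]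
    rw [integral_add ((continuous_duhamel_integrand w f).intervalIntegrable _ _)
      ((continuous_duhamel_integrand w g).intervalIntegrable _ _), mul_add]
  map_smul' c f := by
    ext x
    simp only [duhamelFun, ContinuousMap.coe_mk, ContinuousMap.smul_apply, smul_eq_mul,
      RingHom.id_apply]
    simp only [mul_left_comm _ c, intervalIntegral.integral_const_mul]

theorem norm_duhamelFun_le (w : ℂ) (f : C(unitInterval, ℂ)) (x : unitInterval) :
    ‖duhamelFun w f x‖ ≤ (Real.exp (w.re * x) * ∫ t in (0 : ℝ)..x, Real.exp (-(w.re * t))) * ‖f‖ := by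
  rw [duhamelFun, norm_mul, Complex.norm_exp, mul_assoc]
  have hre : (w * ((x : ℝ) : ℂ)).re = w.re * x := by simp
  rw [hre]
  refine mul_le_mul_of_nonneg_left ?_ (Real.exp_pos _).le
  rw [← intervalIntegral.integral_mul_const]
  refine norm_integral_le_of_norm_le x.2.1 (ae_of_all _ fun t _ => ?_)
    (Continuous.intervalIntegrable (by fun_prop) _ _)
  rw [norm_mul, Complex.norm_exp]
  have hre' : (-(w * (t : ℂ))).re = -(w.re * t) := by simp
  rw [hre']
  exact mul_le_mul_of_nonneg_left (f.norm_coe_le_norm _) (Real.exp_pos _).le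

theorem integral_exp_kernel {a : ℝ} (ha : a ≠ 0) (x : ℝ) :
    Real.exp (a * x) * ∫ t in (0 : ℝ)..x, Real.exp (-(a * t)) = (Real.exp (a * x) - 1) / a := by
  have h : ∀ t ∈ Set.uIcc 0 x,
      HasDerivAt (fun t => -Real.exp (-(a * t)) / a) (Real.exp (-(a * t))) t := fun t _ => by
    have h1 : HasDerivAt (fun t => -(a * t)) (-a) t := by
      simpa using (hasDerivAt_id t).const_mul (-a)
    refine (h1.exp.neg.div_const a).congr_deriv ?_
    field_simp
  rw [integral_eq_sub_of_hasDerivAt h (Continuous.intervalIntegrable (by fun_prop) _ _)]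
  have : Real.exp (a * x) * Real.exp (-(a * x)) = 1 := by rw [← Real.exp_add]; simp
  simp only [mul_zero, neg_zero, Real.exp_zero]
  field_simp
  linear_combination -this

theorem norm_duhamelFun_le_exp (w : ℂ) (f : C(unitInterval, ℂ)) (x : unitInterval) :
    ‖duhamelFun w f x‖ ≤ (Real.exp |w.re| * Real.exp |w.re|) * ‖f‖ := by
  refine (norm_duhamelFun_le w f x).trans ?_
  have hx0 : (0 : ℝ) ≤ x := x.2.1
  have hx1 : (x : ℝ) ≤ 1 := x.2.2
  have hint : ∫ t in (0 : ℝ)..x, Real.exp (-(w.re * t)) ≤ Real.exp |w.re| := by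
    have : ∫ t in (0 : ℝ)..x, Real.exp (-(w.re * t)) ≤ ∫ t in (0 : ℝ)..x, Real.exp |w.re| := by
      refine integral_mono_on hx0 (Continuous.intervalIntegrable (by fun_prop) _ _)
        (Continuous.intervalIntegrable (by fun_prop) _ _) fun t ht => ?_
      refine Real.exp_le_exp.2 ((neg_le_abs _).trans ?_)
      rw [abs_mul, abs_of_nonneg ht.1]
      exact mul_le_of_le_one_right (abs_nonneg _) (ht.2.trans hx1)
    refine this.trans ?_
    rw [intervalIntegral.integral_const, smul_eq_mul, sub_zero]
    exact mul_le_of_le_one_left (Real.exp_pos _).le hx1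
  refine mul_le_mul_of_nonneg_right ?_ (norm_nonneg f)
  refine mul_le_mul (Real.exp_le_exp.2 ?_) hint
    (integral_nonneg hx0 fun t _ => (Real.exp_pos _).le) (Real.exp_pos _).le
  refine (le_abs_self _).trans ?_
  rw [abs_mul, abs_of_nonneg hx0]
  exact mul_le_of_le_one_right (abs_nonneg _) hx1

/-- The bounded operator `f ↦ (x ↦ ∫₀ˣ e^{w (x - t)} f t dt)` on `C([0,1], ℂ)`. -/
noncomputable def duhamel (w : ℂ) : C(unitInterval, ℂ) →L[ℂ] C(unitInterval, ℂ) :=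
  (duhamelLin w).mkContinuous (Real.exp |w.re| * Real.exp |w.re|) fun f =>
    (ContinuousMap.norm_le _ (by positivity)).2 fun x => norm_duhamelFun_le_exp w f x

@[simp] theorem duhamel_apply (w : ℂ) (f : C(unitInterval, ℂ)) (x : unitInterval) :
    duhamel w f x = duhamelFun w f x := rfl

theorem norm_duhamel_le {w : ℂ} (hw : w.re < 0) : ‖duhamel w‖ ≤ 1 / (-w.re) := by
  have hpos : 0 ≤ 1 / (-w.re) := by
    have : 0 < -w.re := by linarith
    positivity
  refine ContinuousLinearMap.opNorm_le_bound _ hpos fun f =>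
    (ContinuousMap.norm_le _ (by positivity)).2 fun x => ?_
  rw [duhamel_apply]
  refine (norm_duhamelFun_le w f x).trans (mul_le_mul_of_nonneg_right ?_ (norm_nonneg f))
  rw [integral_exp_kernel hw.ne, ← neg_div_neg_eq]
  refine div_le_div_of_nonneg_right ?_ (by linarith)
  linarith [Real.exp_pos (w.re * x)]

/-- The Volterra operator `f ↦ (x ↦ ∫₀ˣ f t dt)` on `C([0,1], ℂ)`. -/
noncomputable def volterra : C(unitInterval, ℂ) →L[ℂ] C(unitInterval, ℂ) := duhamel 0

theorem volterra_apply (f : C(unitInterval, ℂ)) (x : unitInterval) :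
    volterra f x = ∫ t in (0 : ℝ)..x, f (Set.projIcc 0 1 zero_le_one t) := by
  simp [volterra, duhamelFun]

theorem volterra_add_smul_duhamel (w : ℂ) (f : C(unitInterval, ℂ)) :
    volterra (f + w • duhamel w f) = duhamel w f := by
  ext x
  have hc : Continuous fun t : ℝ => w * duhamelFun w f t + f (Set.projIcc 0 1 zero_le_one t) := by
    have := continuous_projIcc (a := (0 : ℝ)) (b := 1) (h := zero_le_one)
    have := continuous_duhamelFun w f
    fun_prop
  have h := integral_eq_sub_of_hasDerivAt (a := 0) (b := x)
    (fun t _ => hasDerivAt_duhamelFun w f t) (hc.intervalIntegrable _ _)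
  have h0 : duhamelFun w f 0 = 0 := by simp [duhamelFun]
  rw [h0, sub_zero] at h
  rw [volterra_apply, duhamel_apply, ← h]
  refine integral_congr fun t ht => ?_
  rw [Set.uIcc_of_le x.2.1] at ht
  have ht' : t ∈ Set.Icc (0 : ℝ) 1 := ⟨ht.1, ht.2.trans x.2.2⟩
  simp only [Set.projIcc_of_mem zero_le_one ht', ContinuousMap.add_apply,
    ContinuousMap.smul_apply, duhamel_apply, smul_eq_mul]
  ring

theorem duhamel_sub_smul_volterra (w : ℂ) (f : C(unitInterval, ℂ)) :
    duhamel w (f - w • volterra f) = volterra f := by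
  ext x
  have hd : ∀ t ∈ Set.uIcc (0 : ℝ) x, HasDerivAt
      (fun t : ℝ => Complex.exp (-(w * t)) * duhamelFun 0 f t)
      (Complex.exp (-(w * t)) * (f - w • volterra f) (Set.projIcc 0 1 zero_le_one t)) t := by
    intro t ht
    rw [Set.uIcc_of_le x.2.1] at ht
    have ht' : t ∈ Set.Icc (0 : ℝ) 1 := ⟨ht.1, ht.2.trans x.2.2⟩
    have h3 : HasDerivAt (fun x : ℝ => -(w * (x : ℂ))) (-w) t := by
      simpa using (Complex.ofRealCLM.hasDerivAt (x := t)).const_mul (-w)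
    refine (h3.cexp.mul (hasDerivAt_duhamelFun 0 f t)).congr_deriv ?_
    simp only [Set.projIcc_of_mem zero_le_one ht', ContinuousMap.sub_apply,
      ContinuousMap.smul_apply, volterra, duhamel_apply, smul_eq_mul]
    ring
  rw [duhamel_apply, duhamelFun, integral_eq_sub_of_hasDerivAt hd
    ((continuous_duhamel_integrand w _).intervalIntegrable _ _)]
  have h0 : duhamelFun 0 f 0 = 0 := by simp [duhamelFun]
  rw [h0, mul_zero, sub_zero, ← mul_assoc, ← Complex.exp_add]
  simp [volterra]

theorem one_sub_smul_volterra_mul (w : ℂ) :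
    (1 - w • volterra) * (1 + w • duhamel w) = 1 := by
  refine ContinuousLinearMap.ext fun f => ?_
  change (f + w • duhamel w f) - w • volterra (f + w • duhamel w f) = f
  rw [volterra_add_smul_duhamel, add_sub_cancel_right]

theorem mul_one_sub_smul_volterra (w : ℂ) :
    (1 + w • duhamel w) * (1 - w • volterra) = 1 := by
  refine ContinuousLinearMap.ext fun f => ?_
  change (f - w • volterra f) + w • duhamel w (f - w • volterra f) = f
  rw [duhamel_sub_smul_volterra, sub_add_cancel]

theorem resolv_smul_volterra (z s : ℂ) :
    resolv (z • volterra) s = 1 + (s * z) • duhamel (s * z) := by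
  rw [resolv, smul_smul]
  exact Ring.inverse_unit (⟨_, _, one_sub_smul_volterra_mul (s * z),
    mul_one_sub_smul_volterra (s * z)⟩ : (C(unitInterval, ℂ) →L[ℂ] C(unitInterval, ℂ))ˣ)

theorem isQuasinilpotent_smul_volterra (z : ℂ) : IsQuasinilpotent (z • volterra) := by
  refine (spectrum.nonempty _).subset_singleton_iff.1 fun μ hμ => ?_
  by_contra h0
  have h0 : μ ≠ 0 := h0
  refine hμ ?_
  have h2 : algebraMap ℂ (C(unitInterval, ℂ) →L[ℂ] C(unitInterval, ℂ)) μ - z • volterra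
      = Units.mk0 μ h0 • (1 - (μ⁻¹ * z) • volterra) := by
    rw [Units.smul_mk0, Algebra.algebraMap_eq_smul_one]
    refine ContinuousLinearMap.ext fun f => ?_
    change μ • f - z • volterra f = μ • (f - (μ⁻¹ * z) • volterra f)
    rw [smul_sub, smul_smul, mul_inv_cancel_left₀ h0]
  rw [spectrum.mem_resolventSet_iff, h2]
  exact IsUnit.smul _ ⟨⟨_, _, one_sub_smul_volterra_mul _, mul_one_sub_smul_volterra _⟩, rfl⟩

theorem volterra_pow_one (n : ℕ) (x : unitInterval) :
    (volterra ^ n) 1 x = ((x : ℝ) : ℂ) ^ n / n.factorial := by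
  induction n generalizing x with
  | zero => simp
  | succ n ih =>
    rw [pow_succ']
    change volterra ((volterra ^ n) 1) x = _
    rw [volterra_apply]
    have : ∫ t in (0 : ℝ)..x, ((volterra ^ n) 1) (Set.projIcc 0 1 zero_le_one t)
        = ∫ t in (0 : ℝ)..x, (((t ^ n / n.factorial : ℝ)) : ℂ) := by
      refine integral_congr fun t ht => ?_
      rw [Set.uIcc_of_le x.2.1] at ht
      have ht' : t ∈ Set.Icc (0 : ℝ) 1 := ⟨ht.1, ht.2.trans x.2.2⟩
      simp only [Set.projIcc_of_mem zero_le_one ht', ih]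
      push_cast
      rfl
    rw [this, intervalIntegral.integral_ofReal, intervalIntegral.integral_div, integral_pow,
      Nat.factorial_succ]
    push_cast
    have h1 : (n.factorial : ℂ) ≠ 0 := Nat.cast_ne_zero.2 n.factorial_ne_zero
    have h2 : (n : ℂ) + 1 ≠ 0 := Nat.cast_add_one_ne_zero n
    simp only [ne_eq, Nat.succ_ne_zero, not_false_eq_true, zero_pow, sub_zero]
    field_simp

theorem smul_pow_apply {X : Type*} [NormedAddCommGroup X] [NormedSpace ℂ X]
    (Q : X →L[ℂ] X) (z : ℂ) (n : ℕ) (v : X) : ((z • Q) ^ n) v = z ^ n • (Q ^ n) v := by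
  rw [smul_pow]
  rfl

theorem norm_le_norm_exp_smul {X : Type*} [NormedAddCommGroup X] [NormedSpace ℂ X]
    [CompleteSpace X] (Q : X →L[ℂ] X) (φ : X →L[ℂ] ℂ) (v : X) (c : ℂ) :
    ‖∑' n : ℕ, c ^ n / n.factorial * φ ((Q ^ n) v)‖
      ≤ ‖φ‖ * ‖v‖ * ‖NormedSpace.exp (c • Q)‖ := by
  have h := NormedSpace.exp_series_hasSum_exp' (𝕂 := ℂ) (c • Q)
  have h' := (φ.comp (ContinuousLinearMap.apply ℂ X v)).hasSum h
  have h2 : HasSum (fun n : ℕ => c ^ n / n.factorial * φ ((Q ^ n) v))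
      (φ (NormedSpace.exp (c • Q) v)) := by
    refine h'.congr_fun fun n => ?_
    simp [smul_pow]
    ring
  rw [h2.tsum_eq, mul_assoc, mul_comm ‖v‖]
  exact (φ.le_opNorm _).trans
    (mul_le_mul_of_nonneg_left (ContinuousLinearMap.le_opNorm _ _) (norm_nonneg _))

/-- Evaluation at the right end point, as a functional on `C([0,1], ℂ)`. -/
noncomputable def evalOne : C(unitInterval, ℂ) →L[ℂ] ℂ := ContinuousMap.evalCLM ℂ 1

theorem evalOne_smul_volterra_pow (z : ℂ) (n : ℕ) :
    evalOne (((z • volterra) ^ n) 1) = z ^ n / n.factorial := by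
  rw [smul_pow_apply]
  change z ^ n * ((volterra ^ n) 1 1) = _
  rw [volterra_pow_one]
  simp [div_eq_mul_inv]

theorem norm_evalOne_le : ‖evalOne‖ ≤ 1 :=
  ContinuousLinearMap.opNorm_le_bound _ zero_le_one fun f => by
    rw [one_mul]
    exact f.norm_coe_le_norm 1

theorem integral_rpow_mul_exp_neg {b : ℝ} (hb : 0 < b) (n : ℕ) :
    ∫ t : ℝ in Set.Ioi 0, t ^ n * Real.exp (-(b * t)) = n.factorial / b ^ (n + 1) := by
  have h := Real.integral_rpow_mul_exp_neg_mul_Ioi (a := n + 1) (r := b) (by positivity) hb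
  rw [Real.Gamma_nat_eq_factorial] at h
  simp only [add_sub_cancel_right, Real.rpow_natCast] at h
  rw [h]
  norm_cast
  rw [one_div, inv_pow, div_eq_mul_inv, mul_comm]

theorem norm_pow_mul_exp_neg (a : ℂ) (n : ℕ) {t : ℝ} (ht : 0 < t) :
    ‖(t : ℂ) ^ n * Complex.exp (-(a * t))‖ = t ^ n * Real.exp (-(a.re * t)) := by
  simp [Complex.norm_exp, abs_of_pos ht]

theorem integral_norm_pow_mul_exp_neg {a : ℂ} (ha : 0 < a.re) (n : ℕ) :
    ∫ t : ℝ in Set.Ioi 0, ‖(t : ℂ) ^ n * Complex.exp (-(a * t))‖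
      = n.factorial / a.re ^ (n + 1) := by
  rw [← integral_rpow_mul_exp_neg ha]
  exact setIntegral_congr_fun measurableSet_Ioi fun t ht => norm_pow_mul_exp_neg a n ht

theorem integrableOn_pow_mul_exp_neg {a : ℂ} (ha : 0 < a.re) (n : ℕ) :
    IntegrableOn (fun t : ℝ => (t : ℂ) ^ n * Complex.exp (-(a * t))) (Set.Ioi 0) := by
  have hm : AEStronglyMeasurable (fun t : ℝ => (t : ℂ) ^ n * Complex.exp (-(a * t)))
      (volume.restrict (Set.Ioi 0)) := Continuous.aestronglyMeasurable (by fun_prop)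
  refine (integrable_norm_iff hm).1 (.of_integral_ne_zero ?_)
  rw [integral_norm_pow_mul_exp_neg ha]
  positivity

theorem hasDerivAt_exp_neg_mul (a : ℂ) (t : ℝ) :
    HasDerivAt (fun t : ℝ => Complex.exp (-(a * t))) (-a * Complex.exp (-(a * t))) t := by
  have h : HasDerivAt (fun t : ℝ => -(a * (t : ℂ))) (-a) t := by
    simpa using (Complex.ofRealCLM.hasDerivAt (x := t)).const_mul (-a)
  exact h.cexp.congr_deriv (mul_comm _ _)

theorem tendsto_pow_mul_exp_neg {a : ℂ} (ha : 0 < a.re) (n : ℕ) :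
    Filter.Tendsto (fun t : ℝ => (t : ℂ) ^ n * Complex.exp (-(a * t))) Filter.atTop (nhds 0) := by
  rw [tendsto_zero_iff_norm_tendsto_zero]
  refine (isLittleO_pow_exp_pos_mul_atTop n ha).tendsto_div_nhds_zero.congr' ?_
  filter_upwards [Filter.eventually_gt_atTop 0] with t ht
  rw [norm_pow_mul_exp_neg a n ht, Real.exp_neg, div_eq_mul_inv]

theorem integral_pow_mul_exp_neg {a : ℂ} (ha : 0 < a.re) (n : ℕ) :
    ∫ t : ℝ in Set.Ioi 0, (t : ℂ) ^ n * Complex.exp (-(a * t)) = n.factorial / a ^ (n + 1) := by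
  have ha0 : a ≠ 0 := by
    rintro rfl
    simp at ha
  induction n with
  | zero =>
    have h := integral_exp_mul_complex_Ioi (a := -a) (by simpa using ha) 0
    simpa using h
  | succ n ih =>
    have hd : ∀ t : ℝ, HasDerivAt (fun t : ℝ => (t : ℂ) ^ (n + 1) * Complex.exp (-(a * t)))
        ((n + 1) * ((t : ℂ) ^ n * Complex.exp (-(a * t)))
          + -a * ((t : ℂ) ^ (n + 1) * Complex.exp (-(a * t)))) t := fun t => by
      have h1 : HasDerivAt (fun t : ℝ => (t : ℂ) ^ (n + 1)) ((n + 1) * (t : ℂ) ^ n) t := by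
        simpa using (hasDerivAt_pow (n + 1) (t : ℂ)).comp_ofReal
      refine (h1.mul (hasDerivAt_exp_neg_mul a t)).congr_deriv ?_
      ring
    have i1 := (integrableOn_pow_mul_exp_neg ha n).const_mul ((n : ℂ) + 1)
    have i2 := (integrableOn_pow_mul_exp_neg ha (n + 1)).const_mul (-a)
    have h := integral_Ioi_of_hasDerivAt_of_tendsto' (a := 0) (fun t _ => hd t) (i1.add i2)
      (tendsto_pow_mul_exp_neg ha (n + 1))
    rw [integral_add i1 i2, MeasureTheory.integral_const_mul, MeasureTheory.integral_const_mul, ih] at h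
    simp only [Complex.ofReal_zero, ne_eq, Nat.succ_ne_zero, not_false_eq_true, zero_pow,
      zero_mul, sub_zero] at h
    rw [Nat.factorial_succ, pow_succ, div_mul_eq_div_div, eq_div_iff ha0]
    push_cast
    rw [mul_div_assoc]
    linear_combination -h

/-- Laplace transform of `t ↦ ∑ (t z)ⁿ / (n!)²`. -/
theorem integral_exp_neg_mul_tsum {a : ℂ} (ha : 0 < a.re) (z : ℂ) :
    ∫ t : ℝ in Set.Ioi 0,
      Complex.exp (-(a * t)) * ∑' n : ℕ, (t * z) ^ n / (n.factorial : ℂ) ^ 2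
      = Complex.exp (z / a) / a := by
  have ha0 : a ≠ 0 := by
    rintro rfl
    simp at ha
  have hfac : ∀ n : ℕ, (n.factorial : ℂ) ≠ 0 := fun n => Nat.cast_ne_zero.2 n.factorial_ne_zero
  have hfac' : ∀ n : ℕ, (n.factorial : ℝ) ≠ 0 := fun n => Nat.cast_ne_zero.2 n.factorial_ne_zero
  let F : ℕ → ℝ → ℂ := fun n t =>
    (z ^ n / (n.factorial : ℂ) ^ 2) * ((t : ℂ) ^ n * Complex.exp (-(a * t)))
  have hint : ∀ n, Integrable (F n) (volume.restrict (Set.Ioi 0)) := fun n =>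
    (integrableOn_pow_mul_exp_neg ha n).const_mul _
  have hsum : Summable fun n => ∫ t in Set.Ioi 0, ‖F n t‖ := by
    refine ((Real.summable_pow_div_factorial (‖z‖ / a.re)).mul_right (1 / a.re)).congr fun n => ?_
    simp only [F, norm_mul _ (_ * _)]
    rw [MeasureTheory.integral_const_mul, integral_norm_pow_mul_exp_neg ha]
    have := hfac' n
    have := ha.ne'
    simp only [norm_div, norm_pow, Complex.norm_natCast, div_pow, pow_succ a.re]
    field_simp
  have h := hasSum_integral_of_summable_integral_norm hint hsum
  have h2 : HasSum (fun n : ℕ => (z / a) ^ n / n.factorial * (1 / a)) (Complex.exp (z / a) / a) := by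
    rw [div_eq_mul_one_div (Complex.exp _)]
    refine HasSum.mul_right _ ?_
    rw [Complex.exp_eq_exp_ℂ]
    exact NormedSpace.expSeries_div_hasSum_exp (z / a)
  have h3 : (fun n => ∫ t in Set.Ioi 0, F n t)
      = fun n : ℕ => (z / a) ^ n / n.factorial * (1 / a) := by
    funext n
    simp only [F]
    rw [MeasureTheory.integral_const_mul, integral_pow_mul_exp_neg ha]
    have := hfac n
    rw [div_pow, pow_succ a]
    field_simp
  rw [h3] at h
  rw [← h.unique h2]
  refine setIntegral_congr_fun measurableSet_Ioi fun t _ => ?_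
  simp only [F]
  rw [← tsum_mul_left]
  refine tsum_congr fun n => ?_
  ring

theorem exp_re_div_le_of_polynomial_bound {z : ℂ} {k : ℕ} {A M : ℝ}
    (hb : ∀ t : ℝ, 0 < t → ‖∑' n : ℕ, (t * z) ^ n / (n.factorial : ℂ) ^ 2‖ ≤ A + M * t ^ k)
    {a : ℂ} (ha : 0 < a.re) :
    Real.exp (z / a).re / ‖a‖ ≤ A / a.re + M * (k.factorial / a.re ^ (k + 1)) := by
  have h := integral_exp_neg_mul_tsum ha z
  have hn := congrArg norm h
  rw [norm_div, Complex.norm_exp] at hn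
  rw [← hn]
  have h0 := integral_norm_pow_mul_exp_neg ha 0
  have hk := integral_norm_pow_mul_exp_neg ha k
  simp only [Nat.factorial_zero, zero_add, pow_one, Nat.cast_one] at h0
  rw [div_eq_mul_one_div A, ← h0, ← hk, ← MeasureTheory.integral_const_mul, ← MeasureTheory.integral_const_mul,
    ← integral_add ((integrableOn_pow_mul_exp_neg ha 0).norm.const_mul A)
      ((integrableOn_pow_mul_exp_neg ha k).norm.const_mul M)]
  refine norm_integral_le_of_norm_le
    (((integrableOn_pow_mul_exp_neg ha 0).norm.const_mul A).add
      ((integrableOn_pow_mul_exp_neg ha k).norm.const_mul M)) ?_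
  refine (ae_restrict_iff' measurableSet_Ioi).2 (ae_of_all _ fun t ht => ?_)
  have ht : 0 < t := ht
  rw [norm_mul]
  refine (mul_le_mul_of_nonneg_left (hb t ht) (norm_nonneg _)).trans_eq ?_
  simp only [norm_mul, norm_pow, Complex.norm_real, Real.norm_eq_abs, abs_of_pos ht]
  ring

/-- In the direction `-1 + i` the entire function `∑ wⁿ / (n!)²` grows faster than any power. -/
theorem not_polynomial_bound (k : ℕ) (A M : ℝ) :
    ¬ ∀ t : ℝ, 0 < t →
      ‖∑' n : ℕ, (t * (-1 + Complex.I)) ^ n / (n.factorial : ℂ) ^ 2‖ ≤ A + M * t ^ k := by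
  intro hb
  have key : ∀ y : ℝ, 0 < y →
      Real.exp (1 / 5 * y) ≤ 3 * (|A| + |M| * k.factorial * y ^ k) := by
    intro y hy
    have hre : ((y : ℂ)⁻¹ * (1 + 2 * Complex.I)).re = y⁻¹ := by
      rw [← Complex.ofReal_inv, Complex.re_ofReal_mul]
      simp
    have hy' : (y : ℂ) ≠ 0 := Complex.ofReal_ne_zero.2 hy.ne'
    have hne : (1 + 2 * Complex.I : ℂ) ≠ 0 := fun h => by simpa using congrArg Complex.re h
    have hdiv : ((-1 + Complex.I) / ((y : ℂ)⁻¹ * (1 + 2 * Complex.I))).re = 1 / 5 * y := by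
      have : (-1 + Complex.I) / ((y : ℂ)⁻¹ * (1 + 2 * Complex.I))
          = ((y / 5 : ℝ) : ℂ) * (1 + 3 * Complex.I) := by
        rw [div_eq_iff (mul_ne_zero (inv_ne_zero hy') hne)]
        push_cast
        field_simp
        linear_combination (-6 : ℂ) * Complex.I_sq
      rw [this, Complex.re_ofReal_mul]
      simp
      ring
    have hnorm : ‖(y : ℂ)⁻¹ * (1 + 2 * Complex.I)‖ ≤ 3 * y⁻¹ := by
      rw [norm_mul, norm_inv, Complex.norm_real, Real.norm_eq_abs, abs_of_pos hy, mul_comm]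
      refine mul_le_mul_of_nonneg_right ((norm_add_le _ _).trans ?_) (by positivity)
      simp
      norm_num
    have hpos : 0 < ‖(y : ℂ)⁻¹ * (1 + 2 * Complex.I)‖ :=
      norm_pos_iff.2 (mul_ne_zero (inv_ne_zero hy') hne)
    have h := exp_re_div_le_of_polynomial_bound hb
      (a := (y : ℂ)⁻¹ * (1 + 2 * Complex.I)) (by rw [hre]; positivity)
    rw [hdiv, hre, div_le_iff₀ hpos] at h
    have hup : A / y⁻¹ + M * (k.factorial / y⁻¹ ^ (k + 1))
        ≤ (|A| + |M| * k.factorial * y ^ k) * y := by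
      have e1 : A / y⁻¹ + M * (k.factorial / y⁻¹ ^ (k + 1))
        = (A + M * (k.factorial * y ^ k)) * y := by
        rw [inv_pow, div_inv_eq_mul, div_inv_eq_mul, pow_succ]
        ring
      rw [e1, mul_assoc |M|]
      gcongr
      · exact le_abs_self A
      · exact le_abs_self M
    calc Real.exp (1 / 5 * y)
        ≤ (|A| + |M| * k.factorial * y ^ k) * y * ‖(y : ℂ)⁻¹ * (1 + 2 * Complex.I)‖ :=
          h.trans (mul_le_mul_of_nonneg_right hup hpos.le)
      _ ≤ (|A| + |M| * k.factorial * y ^ k) * y * (3 * y⁻¹) := by gcongr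
      _ = _ := by field_simp
  have hlit : (fun y : ℝ => 3 * (|A| + |M| * k.factorial * y ^ k))
      =o[Filter.atTop] fun y => Real.exp (1 / 5 * y) := by
    refine Asymptotics.IsLittleO.const_mul_left (.add ?_ ?_) 3
    · simpa using (isLittleO_pow_exp_pos_mul_atTop 0
        (by norm_num : (0 : ℝ) < 1 / 5)).const_mul_left |A|
    · exact (isLittleO_pow_exp_pos_mul_atTop k (by norm_num)).const_mul_left _
  have hev := hlit.bound (by norm_num : (0 : ℝ) < 1 / 2)
  obtain ⟨y, hy, hy0⟩ := (hev.and (Filter.eventually_gt_atTop 0)).exists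
  have h1 := key y hy0
  rw [Real.norm_eq_abs, Real.norm_eq_abs, abs_of_pos (Real.exp_pos _)] at hy
  have h2 := le_abs_self (3 * (|A| + |M| * k.factorial * y ^ k))
  linarith [Real.exp_pos (1 / 5 * y)]

theorem norm_tsum_le_exp (w : ℂ) :
    ‖∑' n : ℕ, w ^ n / (n.factorial : ℂ) ^ 2‖ ≤ Real.exp ‖w‖ := by
  have h : HasSum (fun n : ℕ => ‖w‖ ^ n / n.factorial) (Real.exp ‖w‖) := by
    rw [Real.exp_eq_exp_ℝ]
    exact NormedSpace.expSeries_div_hasSum_exp ‖w‖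
  refine tsum_of_norm_bounded h fun n => ?_
  rw [norm_div, norm_pow, norm_pow, Complex.norm_natCast]
  have h1 : (1 : ℝ) ≤ n.factorial := Nat.one_le_cast.2 n.factorial_pos
  refine div_le_div_of_nonneg_left (by positivity) (by positivity) ?_
  nlinarith

theorem mul_mem_sector {δ s : ℝ} {z : ℂ} (hs : 0 < s) (hz : z ∈ sector δ) :
    (s : ℂ) * z ∈ sector δ := by
  obtain ⟨r, φ, hr, hφ, rfl⟩ := hz
  exact ⟨s * r, φ, mul_pos hs hr, hφ, by push_cast; ring⟩

theorem norm_le_mul_neg_re_of_mem_sector {s : ℂ} (hs : s ∈ sector (1 / 4)) :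
    (s * (-1 + Complex.I)).re < 0 ∧
      ‖s * (-1 + Complex.I)‖ ≤ 4 * -(s * (-1 + Complex.I)).re := by
  obtain ⟨r, φ, hr, ⟨h1, h2⟩, rfl⟩ := hs
  have hre : ((r : ℂ) * Complex.exp (φ * Complex.I) * (-1 + Complex.I)).re
      = -(r * (Real.cos φ + Real.sin φ)) := by
    rw [Complex.exp_mul_I, ← Complex.ofReal_cos, ← Complex.ofReal_sin, mul_assoc,
      Complex.re_ofReal_mul]
    simp [-Complex.ofReal_cos, -Complex.ofReal_sin]
    ring
  have hcos := Real.one_sub_sq_div_two_le_cos (x := φ)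
  have habs : |φ| ≤ 1 / 4 := abs_le.2 ⟨h1.le, h2.le⟩
  have hsin : -(1 / 4) ≤ Real.sin φ :=
    (abs_le.1 ((Real.abs_sin_le_abs (x := φ)).trans habs)).1
  have hge : 1 / 2 ≤ Real.cos φ + Real.sin φ := by nlinarith
  have hmul := mul_le_mul_of_nonneg_left hge hr.le
  have hnorm : ‖(r : ℂ) * Complex.exp (φ * Complex.I) * (-1 + Complex.I)‖ ≤ r * 2 := by
    rw [norm_mul, norm_mul, Complex.norm_exp_ofReal_mul_I, Complex.norm_real, Real.norm_eq_abs,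
      abs_of_pos hr, mul_one]
    refine mul_le_mul_of_nonneg_left ((norm_add_le _ _).trans ?_) hr.le
    simp
    norm_num
  rw [hre]
  exact ⟨by linarith, by linarith⟩

theorem norm_one_add_smul_le {X : Type*} [NormedAddCommGroup X] [NormedSpace ℂ X]
    (c : ℂ) (T : X →L[ℂ] X) : ‖1 + c • T‖ ≤ 1 + ‖c‖ * ‖T‖ :=
  (norm_add_le _ _).trans (add_le_add ContinuousLinearMap.norm_id_le (norm_smul_le c T))

theorem norm_resolv_smul_volterra_le {s : ℂ} (hs : s ∈ sector (1 / 4)) :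
    ‖resolv ((-1 + Complex.I) • volterra) s‖ ≤ 5 := by
  obtain ⟨h1, h2⟩ := norm_le_mul_neg_re_of_mem_sector hs
  rw [resolv_smul_volterra]
  refine (norm_one_add_smul_le _ _).trans ?_
  have h3 := (mul_le_mul_of_nonneg_left (norm_duhamel_le h1)
    (norm_nonneg (s * (-1 + Complex.I)))).trans
      ((mul_one_div _ _).trans_le ((div_le_iff₀ (by linarith)).2 h2))
  linarith

theorem norm_tsum_le_norm_exp_smul {X : Type*} [NormedAddCommGroup X] [NormedSpace ℂ X]
    [CompleteSpace X] {Q : X →L[ℂ] X} {φ : X →L[ℂ] ℂ} {v : X} (hφ : ‖φ‖ ≤ 1) (hv : ‖v‖ ≤ 1)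
    {z : ℂ} (hQ : ∀ n : ℕ, φ ((Q ^ n) v) = z ^ n / n.factorial) (c : ℂ) :
    ‖∑' n : ℕ, (c * z) ^ n / (n.factorial : ℂ) ^ 2‖ ≤ ‖NormedSpace.exp (c • Q)‖ := by
  have h := norm_le_norm_exp_smul Q φ v c
  simp only [hQ] at h
  have he : ∀ n : ℕ, (c * z) ^ n / (n.factorial : ℂ) ^ 2
      = c ^ n / n.factorial * (z ^ n / n.factorial) := fun n => by
    rw [mul_pow, sq, mul_div_mul_comm]
  simp only [he]
  exact h.trans (mul_le_of_le_one_left (norm_nonneg _)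
    (mul_le_one₀ hφ (norm_nonneg _) hv))

end Microspectral

theorem proposition8p3 :
    ∃ (X : Type) (_ : NormedAddCommGroup X) (_ : NormedSpace ℂ X) (_ : CompleteSpace X)
      (Q : X →L[ℂ] X),
      Microspectral.IsQuasinilpotent Q ∧
      (∃ δ : ℝ, 0 < δ ∧ δ < Real.pi / 2 ∧
        (∃ C : ℝ, ∀ s ∈ Microspectral.sector δ, ‖Microspectral.resolv Q s‖ ≤ C) ∧
        Microspectral.sector δ ⊆ Microspectral.abelSet Q) ∧
      ∀ (k : ℕ), 1 ≤ k → ∀ (M t₀ : ℝ), 0 ≤ t₀ →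
        ¬ ∀ t : ℝ, t₀ ≤ t → ‖NormedSpace.exp ((t : ℂ) • Q)‖ ≤ M * t ^ k := by
  refine ⟨C(unitInterval, ℂ), inferInstance, inferInstance, inferInstance,
    (-1 + Complex.I) • Microspectral.volterra,
    Microspectral.isQuasinilpotent_smul_volterra _, ⟨1 / 4, by norm_num, ?_,
      ⟨5, fun s hs => Microspectral.norm_resolv_smul_volterra_le hs⟩, fun z hz => ⟨5, ?_⟩⟩, ?_⟩
  · linarith [Real.pi_gt_three]
  · filter_upwards [Filter.eventually_gt_atTop 0] with s hs
    exact Microspectral.norm_resolv_smul_volterra_le (Microspectral.mul_mem_sector hs hz)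
  · intro k _ M t₀ _ hbound
    refine Microspectral.not_polynomial_bound k
      (Real.exp (t₀ * ‖(-1 + Complex.I : ℂ)‖)) |M| fun t ht => ?_
    rcases le_total t₀ t with h | h
    · refine (Microspectral.norm_tsum_le_norm_exp_smul Microspectral.norm_evalOne_le
        norm_one.le (Microspectral.evalOne_smul_volterra_pow _) _).trans
        ((hbound t h).trans ?_)
      have := mul_le_mul_of_nonneg_right (le_abs_self M) (pow_nonneg ht.le k)
      linarith [Real.exp_pos (t₀ * ‖(-1 + Complex.I : ℂ)‖)]
    · refine (Microspectral.norm_tsum_le_exp _).trans ?_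
      have h1 : Real.exp ‖(t : ℂ) * (-1 + Complex.I)‖
          ≤ Real.exp (t₀ * ‖(-1 + Complex.I : ℂ)‖) := by
        rw [norm_mul, Complex.norm_real, Real.norm_eq_abs, abs_of_pos ht]
        gcongr
      have : 0 ≤ |M| * t ^ k := by positivity
      linarith
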